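/- Let $m,n,L,r$ be positive integers and let $\mathcal{A}:\mathbb{R}^{m\times n}\to\mathbb{R}^L$ be a linear map. For a matrix $X\in\mathbb{R}^{m\times n}$ with singular values $\sigma_1\ge\dots\ge\sigma_{\min\{m,n\}}\ge 0$ and for $0<t<\infty$ put $\|X\|_{S_t}=\big(\sum_{j=1}^{\min\{m,n\}}\sigma_j^t\big)^{1/t}$, and for $z\in\mathbb{R}^L$ put $\|z\|_t=\big(\sum_{j=1}^L|z_j|^t\big)^{1/t}$. For $0<q\le 1$ and a positive integer $N$, say that $\mathcal{A}$ satisfies the $\ell_q$-restricted uniform boundedness ($\ell_q$-RUB) condition of order $N$ with constants $C_1,C_2$ if $$C_1\|X\|_{S_2}^q\le \frac{1}{L}\|\mathcal{A}(X)\|_q^q\le C_2\|X\|_{S_2}^q$$ for all nonzero $X\in\mathbb{R}^{m\times n}$ of rank at most $N$. Theorem. Let $k>1$ be a real number such that $kr$ is an integer, and let $0<p\le q\le 1$. Suppose that $\mathcal{A}$ satisfies the $\ell_q$-RUB condition of order $(k+1)r$ with constants $C_1>0$ and $C_2\in\mathbb{R}$ such that $C_2/C_1<k^{(1/p-1/2)q}$.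 Then for every $X\in\mathbb{R}^{m\times n}$ of rank at most $r$, with $b=\mathcal{A}(X)$, the noiseless Schatten-$p$ minimization problem $$\min_{Y\in\mathbb{R}^{m\times n}}\|Y\|_{S_p}^p\quad\text{subject to}\quad \mathcal{A}(Y)=b$$ has $X$ as its unique solution; that is, $\hat X\in\mathbb{R}^{m\times n}$ is a global minimizer if and only if $\hat X=X$. -/

import Mathlib

noncomputable section

/-- The `j`-th largest singular value (indexed from `0`) of a real `m × n` matrix: Mathlib's
singular values of the linear map `ℝⁿ → ℝᵐ` between Euclidean spaces that the matrix represents. -/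
def matrixSingularValue {m n : ℕ} (X : Matrix (Fin m) (Fin n) ℝ) (j : ℕ) : ℝ :=
  (Matrix.toEuclideanLin X).singularValues j

/-- The Schatten `p`-(quasi)norm `‖X‖_{S_p} = (∑_{j < min(m,n)} |σ_j(X)|^p)^{1/p}`, `0 < p < ∞`. -/
def schattenNorm {m n : ℕ} (p : ℝ) (X : Matrix (Fin m) (Fin n) ℝ) : ℝ :=
  (∑ j ∈ Finset.range (min m n), |matrixSingularValue X j| ^ p) ^ (1 / p)

/-- The `ℓ_q`-(quasi)norm `‖z‖_q = (∑_j |z_j|^q)^{1/q}` of a vector, `0 < q < ∞`. -/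
def lqNorm {L : ℕ} (q : ℝ) (z : Fin L → ℝ) : ℝ :=
  (∑ j, |z j| ^ q) ^ (1 / q)

/-- `ℓ_q`-restricted uniform boundedness of order `N` with constants `C₁`, `C₂`:
`C₁ ‖X‖_{S_2}^q ≤ ‖𝒜(X)‖_q^q / L ≤ C₂ ‖X‖_{S_2}^q` for all nonzero `X` of rank at most `N`. -/
def LqRUB {m n L : ℕ} (𝒜 : Matrix (Fin m) (Fin n) ℝ →ₗ[ℝ] (Fin L → ℝ))
    (q : ℝ) (N : ℕ) (C₁ C₂ : ℝ) : Prop :=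
  ∀ X : Matrix (Fin m) (Fin n) ℝ, X ≠ 0 → X.rank ≤ N →
    C₁ * schattenNorm 2 X ^ q ≤ lqNorm q (𝒜 X) ^ q / (L : ℝ) ∧
      lqNorm q (𝒜 X) ^ q / (L : ℝ) ≤ C₂ * schattenNorm 2 X ^ q

/-- `Xhat` is a (global) solution of `min ‖X‖_{S_p}^p` subject to `b - 𝒜(X) ∈ 𝓑`. -/
def IsSchattenMinimizer {m n L : ℕ} (𝒜 : Matrix (Fin m) (Fin n) ℝ →ₗ[ℝ] (Fin L → ℝ))
    (b : Fin L → ℝ) (𝓑 : Set (Fin L → ℝ)) (p : ℝ) (Xhat : Matrix (Fin m) (Fin n) ℝ) : Prop :=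
  b - 𝒜 Xhat ∈ 𝓑 ∧
    ∀ Y : Matrix (Fin m) (Fin n) ℝ, b - 𝒜 Y ∈ 𝓑 → schattenNorm p Xhat ^ p ≤ schattenNorm p Y ^ p

end

/-! Let `Y` be feasible with Schatten `p`-norm at most that of `X`, and put `R = X - Y`, a matrix in
the kernel of `𝒜`. The claim is `R = 0`.

Since `X - R = Y`, the inequality `∑ |σ_j(X)^p - σ_j(R)^p| ≤ ∑ σ_j(Y)^p` and the rank bound on `X`
show that the first `r` values `σ_j(R)^p` dominate the sum of the others
(`LinearMap.sum_Ico_singularValues_rpow_le`). Cut the singular value decomposition of `R` into a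
head of rank at most `r + s` and blocks of rank at most `s = kr`. As `𝒜 R = 0`, the lower RUB bound
on the head, the upper one on the blocks and the `q`-triangle inequality control the head by the
blocks. Monotonicity bounds each block in `ℓ_2` by its predecessor in `ℓ_p`, so `C₁ Q ≤ C₂ k^(q/2 -
q/p) Q`, with `Q` the `q`-th power of the `ℓ_2` norm of the first `r` singular values. The
hypothesis on `C₂ / C₁` forces `Q = 0`, hence `R = 0`.

The hard ingredient is the perturbation inequality (`LinearMap.sum_abs_singularValues_rpow_sub_le`).
Adding the rank-one pieces of `A - B` one at a time reduces it to rank one. There interlacing keeps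
the intervals between old and new singular values from overlapping, Mirsky's inequality bounds their
total length by the norm of the perturbation, and concavity of `t^p` makes the worst case a single
interval starting at `0`. -/

open Module InnerProductSpace

/-! ### Min-max bounds for eigenvalues and singular values. -/

section MinMax

variable {E : Type*} [NormedAddCommGroup E] [InnerProductSpace ℝ E]

/-- The span of the members of an orthonormal basis with index in `S`. -/
def OrthonormalBasis.spanOn {n : ℕ} (b : OrthonormalBasis (Fin n) ℝ E) (S : Finset (Fin n)) :
    Submodule ℝ E :=
  Submodule.span ℝ (Set.range fun i : S => b i)

theorem OrthonormalBasis.finrank_spanOn {n : ℕ} (b : OrthonormalBasis (Fin n) ℝ E)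
    (S : Finset (Fin n)) : finrank ℝ (b.spanOn S) = S.card := by
  have h : LinearIndependent ℝ (fun i : S => b i) :=
    b.orthonormal.linearIndependent.comp _ Subtype.val_injective
  rw [OrthonormalBasis.spanOn, finrank_span_eq_card h, Fintype.card_coe]

theorem OrthonormalBasis.inner_eq_zero_of_mem_spanOn {n : ℕ} (b : OrthonormalBasis (Fin n) ℝ E)
    {S : Finset (Fin n)} {x : E} (hx : x ∈ b.spanOn S) {i : Fin n} (hi : i ∉ S) :
    inner ℝ (b i) x = 0 := by
  induction hx using Submodule.span_induction with
  | mem x h =>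
    obtain ⟨⟨j, hj⟩, rfl⟩ := h
    exact b.orthonormal.2 (fun h => hi (h ▸ hj))
  | zero => simp
  | add x y _ _ hx hy => rw [inner_add_right, hx, hy, add_zero]
  | smul a x _ hx => rw [inner_smul_right, hx, mul_zero]

theorem OrthonormalBasis.norm_sq_eq_sum_inner_sq {n : ℕ} (b : OrthonormalBasis (Fin n) ℝ E)
    (x : E) : ‖x‖ ^ 2 = ∑ i, inner ℝ (b i) x ^ 2 := by
  rw [← b.sum_sq_norm_inner_right x]
  simp

variable [FiniteDimensional ℝ E]

theorem Submodule.exists_mem_inf_ne_zero_of_finrank_lt (V W : Submodule ℝ E)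
    (h : finrank ℝ E < finrank ℝ V + finrank ℝ W) : ∃ x ∈ V, x ∈ W ∧ x ≠ 0 := by
  have h1 := Submodule.finrank_sup_add_finrank_inf_eq V W
  have h2 := Submodule.finrank_le (V ⊔ W)
  have h3 : V ⊓ W ≠ ⊥ := by
    intro h0
    rw [h0, finrank_bot] at h1
    omega
  obtain ⟨x, hx, hx0⟩ := Submodule.exists_mem_ne_zero_of_ne_bot h3
  exact ⟨x, hx.1, hx.2, hx0⟩

theorem LinearMap.IsSymmetric.inner_apply_eq_sum {n : ℕ} {T : E →ₗ[ℝ] E} (hT : T.IsSymmetric)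
    (hn : finrank ℝ E = n) (x : E) :
    inner ℝ (T x) x = ∑ i, hT.eigenvalues hn i * inner ℝ (hT.eigenvectorBasis hn i) x ^ 2 := by
  rw [← (hT.eigenvectorBasis hn).sum_inner_mul_inner]
  refine Finset.sum_congr rfl fun i _ => ?_
  rw [hT, hT.apply_eigenvectorBasis, inner_smul_right, real_inner_comm]
  simp only [RCLike.ofReal_real_eq_id, id_eq]
  ring

/-- By dimension, `V` meets the span of the eigenvectors of index at least `i`, where the quadratic
form is at most the `i`-th eigenvalue times `‖x‖ ^ 2`. This is one half of Courant–Fischer;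
`eigenvalues_le` is the dual half. -/
theorem LinearMap.IsSymmetric.le_eigenvalues {n : ℕ} {T : E →ₗ[ℝ] E} (hT : T.IsSymmetric)
    (hn : finrank ℝ E = n) (V : Submodule ℝ E) (c : ℝ) (i : Fin n) (hV : i < finrank ℝ V)
    (h : ∀ x ∈ V, c * ‖x‖ ^ 2 ≤ inner ℝ (T x) x) : c ≤ hT.eigenvalues hn i := by
  set b := hT.eigenvectorBasis hn with hb
  obtain ⟨x, hxV, hxW, hx0⟩ := Submodule.exists_mem_inf_ne_zero_of_finrank_lt V
    (b.spanOn (Finset.Ici i)) (by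
      rw [b.finrank_spanOn, Fin.card_Ici]; omega)
  have hx : 0 < ‖x‖ ^ 2 := by positivity
  refine le_of_mul_le_mul_right ((h x hxV).trans ?_) hx
  rw [hT.inner_apply_eq_sum hn, b.norm_sq_eq_sum_inner_sq, Finset.mul_sum]
  refine Finset.sum_le_sum fun j _ => ?_
  by_cases hj : i ≤ j
  · exact mul_le_mul_of_nonneg_right (hT.eigenvalues_antitone hn hj) (sq_nonneg _)
  · rw [b.inner_eq_zero_of_mem_spanOn hxW (by simpa using hj)]
    simp

theorem LinearMap.IsSymmetric.eigenvalues_le {n : ℕ} {T : E →ₗ[ℝ] E} (hT : T.IsSymmetric)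
    (hn : finrank ℝ E = n) (V : Submodule ℝ E) (c : ℝ) (i : Fin n) (hV : n ≤ finrank ℝ V + i)
    (h : ∀ x ∈ V, inner ℝ (T x) x ≤ c * ‖x‖ ^ 2) : hT.eigenvalues hn i ≤ c := by
  set b := hT.eigenvectorBasis hn with hb
  obtain ⟨x, hxV, hxW, hx0⟩ := Submodule.exists_mem_inf_ne_zero_of_finrank_lt V
    (b.spanOn (Finset.Iic i)) (by
      rw [b.finrank_spanOn, Fin.card_Iic]; omega)
  have hx : 0 < ‖x‖ ^ 2 := by positivity
  refine le_of_mul_le_mul_right (le_trans ?_ (h x hxV)) hx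
  rw [hT.inner_apply_eq_sum hn, b.norm_sq_eq_sum_inner_sq, Finset.mul_sum]
  refine Finset.sum_le_sum fun j _ => ?_
  by_cases hj : j ≤ i
  · exact mul_le_mul_of_nonneg_right (hT.eigenvalues_antitone hn hj) (sq_nonneg _)
  · rw [b.inner_eq_zero_of_mem_spanOn hxW (by simpa using hj)]
    simp

theorem LinearMap.IsSymmetric.eigenvalues_mono {n : ℕ} {S T : E →ₗ[ℝ] E} (hS : S.IsSymmetric)
    (hT : T.IsSymmetric) (hn : finrank ℝ E = n) (h : ∀ x, inner ℝ (S x) x ≤ inner ℝ (T x) x)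
    (i : Fin n) : hS.eigenvalues hn i ≤ hT.eigenvalues hn i := by
  set b := hS.eigenvectorBasis hn with hb
  refine hT.le_eigenvalues hn (b.spanOn (Finset.Iic i)) _ i
    (by rw [b.finrank_spanOn, Fin.card_Iic]; omega) fun x hx => le_trans ?_ (h x)
  rw [hS.inner_apply_eq_sum hn, b.norm_sq_eq_sum_inner_sq, Finset.mul_sum]
  refine Finset.sum_le_sum fun j _ => ?_
  by_cases hj : j ≤ i
  · exact mul_le_mul_of_nonneg_right (hS.eigenvalues_antitone hn hj) (sq_nonneg _)
  · rw [b.inner_eq_zero_of_mem_spanOn hx (by simpa using hj)]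
    simp

/-- If `S ≤ T` and `S' ≤ T`, the eigenvalues of `S` and `S'` differ in total by at most
`tr (T - S) + tr (T - S')`. -/
theorem LinearMap.IsSymmetric.sum_abs_eigenvalues_sub_le {n : ℕ} {S S' T : E →ₗ[ℝ] E}
    (hS : S.IsSymmetric) (hS' : S'.IsSymmetric) (hT : T.IsSymmetric) (hn : finrank ℝ E = n)
    (h : ∀ x, inner ℝ (S x) x ≤ inner ℝ (T x) x) (h' : ∀ x, inner ℝ (S' x) x ≤ inner ℝ (T x) x) :
    ∑ i, |hS.eigenvalues hn i - hS'.eigenvalues hn i| ≤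
      (T.trace ℝ E - S.trace ℝ E) + (T.trace ℝ E - S'.trace ℝ E) := by
  rw [hS.trace_eq_sum_eigenvalues hn, hS'.trace_eq_sum_eigenvalues hn,
    hT.trace_eq_sum_eigenvalues hn]
  simp only [RCLike.ofReal_real_eq_id, id_eq]
  rw [← Finset.sum_sub_distrib, ← Finset.sum_sub_distrib, ← Finset.sum_add_distrib]
  refine Finset.sum_le_sum fun i _ => ?_
  -- Both `i`-th eigenvalues lie below that of `T`, so their distance is at most the sum of the two
  -- gaps.
  have h1 := hS.eigenvalues_mono hT hn h i
  have h2 := hS'.eigenvalues_mono hT hn h' i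
  rw [abs_le]
  constructor <;> linarith

variable {F : Type*} [NormedAddCommGroup F] [InnerProductSpace ℝ F] [FiniteDimensional ℝ F]

/-- A basis of right singular vectors. -/
theorem LinearMap.exists_rightSingularBasis {n : ℕ} (T : E →ₗ[ℝ] F) (hn : finrank ℝ E = n) :
    ∃ b : OrthonormalBasis (Fin n) ℝ E, ∀ i j,
      inner ℝ (T (b i)) (T (b j)) = if i = j then T.singularValues i ^ 2 else 0 := by
  refine ⟨T.isSymmetric_adjoint_comp_self.eigenvectorBasis hn, fun i j => ?_⟩
  rw [← LinearMap.adjoint_inner_right, ← LinearMap.comp_apply,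
    T.isSymmetric_adjoint_comp_self.apply_eigenvectorBasis hn, inner_smul_right,
    OrthonormalBasis.inner_eq_ite, ← T.sq_singularValues_fin hn]
  split_ifs with h <;> simp [h]

theorem LinearMap.le_singularValues (T : E →ₗ[ℝ] F) (V : Submodule ℝ E) {c : ℝ} (hc : 0 ≤ c)
    {i : ℕ} (hV : i < finrank ℝ V) (h : ∀ x ∈ V, c * ‖x‖ ≤ ‖T x‖) : c ≤ T.singularValues i := by
  have hi : i < finrank ℝ E := hV.trans_le (Submodule.finrank_le V)
  refine le_of_sq_le_sq ?_ (T.singularValues_nonneg i)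
  rw [T.sq_singularValues_of_lt rfl hi]
  refine T.isSymmetric_adjoint_comp_self.le_eigenvalues rfl V _ _ hV fun x hx => ?_
  rw [LinearMap.comp_apply, LinearMap.adjoint_inner_left, real_inner_self_eq_norm_sq, ← mul_pow]
  exact pow_le_pow_left₀ (by positivity) (h x hx) 2

end MinMax

/-! ### Spectrum of the symmetric dilation: the singular values and their negatives. -/

section Dilation

variable {E : Type*} [NormedAddCommGroup E] [InnerProductSpace ℝ E]
  {F : Type*} [NormedAddCommGroup F] [InnerProductSpace ℝ F]

theorem LinearMap.apply_eq_sum_orthonormalBasis {n : ℕ} (T : E →ₗ[ℝ] F) (b : OrthonormalBasis (Fin n) ℝ E) (x : E) :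
    T x = ∑ i, inner ℝ (b i) x • T (b i) := by
  conv_lhs => rw [← b.sum_repr' x, map_sum]
  simp

/-- The graph of `W`, restricted to the span of the first `j + 1` vectors of `b`. -/
noncomputable def LinearMap.headGraph {n : ℕ} (W : E →ₗ[ℝ] F) (b : OrthonormalBasis (Fin n) ℝ E) (j : Fin n) :
    Submodule ℝ (WithLp 2 (E × F)) :=
  (b.spanOn (Finset.Iic j)).map
    ((WithLp.linearEquiv 2 ℝ (E × F)).symm.toLinearMap ∘ₗ LinearMap.prod LinearMap.id W)

theorem LinearMap.finrank_headGraph {n : ℕ} (W : E →ₗ[ℝ] F) (b : OrthonormalBasis (Fin n) ℝ E)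
    (j : Fin n) : finrank ℝ (W.headGraph b j) = j + 1 := by
  rw [LinearMap.headGraph, LinearEquiv.finrank_eq (Submodule.equivMapOfInjective _ ?_ _).symm,
    b.finrank_spanOn, Fin.card_Iic]
  intro x y h
  have := congrArg WithLp.fst h
  simpa using this

variable [FiniteDimensional ℝ E] [FiniteDimensional ℝ F]

/-- `b` consists of right singular vectors of `T`, in the order of the singular values. -/
def LinearMap.IsRightSingularBasis {n : ℕ} (T : E →ₗ[ℝ] F) (b : OrthonormalBasis (Fin n) ℝ E) :
    Prop :=
  ∀ i j, inner ℝ (T (b i)) (T (b j)) = if i = j then T.singularValues i ^ 2 else 0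

namespace LinearMap.IsRightSingularBasis

variable {n : ℕ} {T : E →ₗ[ℝ] F} {b : OrthonormalBasis (Fin n) ℝ E}

theorem inner_sum_sum (hb : T.IsRightSingularBasis b) (a c : Fin n → ℝ) :
    inner ℝ (∑ i, a i • T (b i)) (∑ i, c i • T (b i)) =
      ∑ i, a i * c i * T.singularValues i ^ 2 := by
  simp only [sum_inner, inner_sum, inner_smul_left, inner_smul_right, hb _ _]
  refine Finset.sum_congr rfl fun i _ => ?_
  simp only [conj_trivial, mul_ite, mul_zero, Finset.sum_ite_eq', Finset.mem_univ, if_true]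
  ring

theorem norm_sq_apply (hb : T.IsRightSingularBasis b) (x : E) :
    ‖T x‖ ^ 2 = ∑ i : Fin n, T.singularValues i ^ 2 * inner ℝ (b i) x ^ 2 := by
  rw [← real_inner_self_eq_norm_sq, T.apply_eq_sum_orthonormalBasis b x, hb.inner_sum_sum]
  exact Finset.sum_congr rfl fun i _ => by ring

/-- The partial isometry of the polar decomposition. -/
theorem exists_polar (hb : T.IsRightSingularBasis b) : ∃ W : E →ₗ[ℝ] F, (∀ x, ‖W x‖ ^ 2 ≤ ‖x‖ ^ 2) ∧
    ∀ x, inner ℝ (T x) (W x) = ∑ i : Fin n, T.singularValues i * inner ℝ (b i) x ^ 2 := by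
  -- When the singular value is `0` its inverse is `0` by convention, so `W` kills that basis
  -- vector; hence `W` is only a contraction.
  let W : E →ₗ[ℝ] F := b.toBasis.constr ℝ fun i => (T.singularValues i)⁻¹ • T (b i)
  have hWb : ∀ i, W (b i) = (T.singularValues i)⁻¹ • T (b i) := fun i => by
    have := b.toBasis.constr_basis ℝ (fun i : Fin n => (T.singularValues i)⁻¹ • T (b i)) i
    rwa [b.coe_toBasis] at this
  have hW : ∀ x, W x = ∑ i, (inner ℝ (b i) x * (T.singularValues i)⁻¹) • T (b i) := fun x => by
    rw [W.apply_eq_sum_orthonormalBasis b x]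
    exact Finset.sum_congr rfl fun i _ => by rw [hWb, smul_smul]
  refine ⟨W, fun x => ?_, fun x => ?_⟩
  · rw [← real_inner_self_eq_norm_sq, hW, hb.inner_sum_sum, b.norm_sq_eq_sum_inner_sq]
    refine Finset.sum_le_sum fun i _ => ?_
    by_cases h : T.singularValues i = 0
    · simp [h, sq_nonneg]
    · field_simp; exact le_rfl
  · rw [hW, T.apply_eq_sum_orthonormalBasis b x, hb.inner_sum_sum]
    refine Finset.sum_congr rfl fun i _ => ?_
    by_cases h : T.singularValues i = 0
    · simp [h]
    · field_simp

end LinearMap.IsRightSingularBasis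

/-- The symmetric dilation `(x, y) ↦ (T* y, T x)` of `T`. -/
noncomputable def LinearMap.dilation (T : E →ₗ[ℝ] F) : WithLp 2 (E × F) →ₗ[ℝ] WithLp 2 (E × F) where
  toFun z := WithLp.toLp 2 (LinearMap.adjoint T z.snd, T z.fst)
  map_add' z w := by simp [← WithLp.toLp_add]
  map_smul' a z := by simp [← WithLp.toLp_smul]

theorem LinearMap.inner_dilation (T : E →ₗ[ℝ] F) (z w : WithLp 2 (E × F)) :
    inner ℝ (T.dilation z) w = inner ℝ z.snd (T w.fst) + inner ℝ (T z.fst) w.snd := by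
  rw [← LinearMap.adjoint_inner_left, WithLp.prod_inner_apply]
  rfl

theorem LinearMap.isSymmetric_dilation (T : E →ₗ[ℝ] F) : T.dilation.IsSymmetric := by
  intro z w
  rw [T.inner_dilation, real_inner_comm (T.dilation w), T.inner_dilation, add_comm,
    real_inner_comm w.snd, real_inner_comm (T w.fst)]

theorem LinearMap.inner_dilation_apply (T : E →ₗ[ℝ] F) (z : WithLp 2 (E × F)) :
    inner ℝ (T.dilation z) z = 2 * inner ℝ (T z.fst) z.snd := by
  rw [T.inner_dilation, real_inner_comm, two_mul]

/-- In a product basis every vector has a zero component, so the diagonal entries vanish. -/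
theorem LinearMap.trace_dilation (T : E →ₗ[ℝ] F) :
    LinearMap.trace ℝ (WithLp 2 (E × F)) T.dilation = 0 := by
  let b := ((stdOrthonormalBasis ℝ E).prod (stdOrthonormalBasis ℝ F))
  rw [LinearMap.trace_eq_sum_inner _ b]
  refine Finset.sum_eq_zero fun i _ => ?_
  rw [real_inner_comm, T.inner_dilation_apply]
  rcases i with i | i <;> simp [b]

/-- The part of `E × F` whose first component is orthogonal to the first `j` vectors of `b`. -/
noncomputable def LinearMap.tailSubspace {n : ℕ} (F : Type*) [NormedAddCommGroup F] [InnerProductSpace ℝ F]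
    (b : OrthonormalBasis (Fin n) ℝ E) (j : Fin n) : Submodule ℝ (WithLp 2 (E × F)) :=
  LinearMap.ker (LinearMap.pi fun i : Fin j =>
    (innerₗ E (b ⟨i, i.2.trans j.2⟩)).comp (LinearMap.fst ℝ E F ∘ₗ
      (WithLp.linearEquiv 2 ℝ (E × F)).toLinearMap))

theorem LinearMap.le_finrank_tailSubspace {n : ℕ} (b : OrthonormalBasis (Fin n) ℝ E) (j : Fin n) :
    finrank ℝ (WithLp 2 (E × F)) ≤ finrank ℝ (LinearMap.tailSubspace F b j) + j := by
  rw [LinearMap.tailSubspace]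
  rw [← LinearMap.finrank_range_add_finrank_ker (LinearMap.pi fun i : Fin j =>
    (innerₗ E (b ⟨i, i.2.trans j.2⟩)).comp (LinearMap.fst ℝ E F ∘ₗ
      (WithLp.linearEquiv 2 ℝ (E × F)).toLinearMap)), add_comm]
  exact Nat.add_le_add_left ((Submodule.finrank_le _).trans (by simp)) _

/-- On the tail `‖T x‖ ≤ σ_j ‖x‖`, and `2 ‖x‖ ‖y‖ ≤ ‖x‖ ^ 2 + ‖y‖ ^ 2`. The absolute value serves
both ends of the spectrum. -/
theorem LinearMap.IsRightSingularBasis.abs_inner_le_of_mem_tailSubspace {n : ℕ} {T : E →ₗ[ℝ] F}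
    {b : OrthonormalBasis (Fin n) ℝ E} (hb : T.IsRightSingularBasis b) (j : Fin n)
    {z : WithLp 2 (E × F)} (hz : z ∈ LinearMap.tailSubspace F b j) :
    |inner ℝ (T.dilation z) z| ≤ T.singularValues j * ‖z‖ ^ 2 := by
  have hz0 : ∀ i < j, inner ℝ (b i) z.fst = 0 := fun i hi => by
    have := congrFun (LinearMap.mem_ker.1 hz) (⟨i, hi⟩ : Fin j)
    simpa using this
  have hs := T.singularValues_nonneg j
  have h1 : ‖T z.fst‖ ≤ T.singularValues j * ‖z.fst‖ := by
    refine le_of_sq_le_sq ?_ (by positivity)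
    rw [hb.norm_sq_apply, mul_pow, b.norm_sq_eq_sum_inner_sq, Finset.mul_sum]
    refine Finset.sum_le_sum fun i _ => ?_
    by_cases hi : i < j
    · simp [hz0 i hi]
    · have : T.singularValues i ≤ T.singularValues j := T.singularValues_antitone (not_lt.1 hi)
      exact mul_le_mul_of_nonneg_right (pow_le_pow_left₀ (T.singularValues_nonneg i) this 2)
        (sq_nonneg _)
  have h2 := abs_real_inner_le_norm (T z.fst) z.snd
  rw [T.inner_dilation_apply, abs_mul, abs_two, WithLp.prod_norm_sq_eq_of_L2]
  have h3 := mul_le_mul_of_nonneg_right h1 (norm_nonneg z.snd)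
  nlinarith [mul_nonneg hs (sq_nonneg (‖z.fst‖ - ‖z.snd‖))]

/-- On the graph of `W` over the head, the dilation form is at least `σ_j` times the squared norm;
the graph of `-W` reverses the sign. -/
theorem LinearMap.IsRightSingularBasis.le_inner_of_polar {n : ℕ} {T : E →ₗ[ℝ] F}
    {b : OrthonormalBasis (Fin n) ℝ E} (W : E →ₗ[ℝ] F)
    (hW : ∀ x, ‖W x‖ ^ 2 ≤ ‖x‖ ^ 2)
    (hTW : ∀ x, inner ℝ (T x) (W x) = ∑ i : Fin n, T.singularValues i * inner ℝ (b i) x ^ 2)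
    (j : Fin n) {x : E} (hx : x ∈ b.spanOn (Finset.Iic j)) :
    T.singularValues j * (‖x‖ ^ 2 + ‖W x‖ ^ 2) ≤ 2 * inner ℝ (T x) (W x) := by
  have h1 : T.singularValues j * ‖x‖ ^ 2 ≤ inner ℝ (T x) (W x) := by
    rw [hTW, b.norm_sq_eq_sum_inner_sq, Finset.mul_sum]
    refine Finset.sum_le_sum fun i _ => ?_
    by_cases hi : i ≤ j
    · have : T.singularValues j ≤ T.singularValues i := T.singularValues_antitone hi
      gcongr
    · rw [b.inner_eq_zero_of_mem_spanOn hx (by simpa using hi)]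
      simp
  nlinarith [mul_le_mul_of_nonneg_left (hW x) (T.singularValues_nonneg j)]

/-- The tail subspace, of codimension at most `j`, gives the upper bound; the graph of the polar
factor over the head, of dimension `j + 1`, gives the lower one. -/
theorem LinearMap.eigenvalues_dilation (T : E →ₗ[ℝ] F) {N : ℕ}
    (hN : finrank ℝ (WithLp 2 (E × F)) = N) {j : ℕ} (hj : j < finrank ℝ E) (hjN : j < N) :
    T.isSymmetric_dilation.eigenvalues hN ⟨j, hjN⟩ = T.singularValues j := by
  obtain ⟨b, hb⟩ := T.exists_rightSingularBasis rfl
  obtain ⟨W, hW, hTW⟩ := LinearMap.IsRightSingularBasis.exists_polar hb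
  refine le_antisymm ?_ ?_
  · have h := LinearMap.le_finrank_tailSubspace (F := F) b ⟨j, hj⟩
    refine T.isSymmetric_dilation.eigenvalues_le hN _ _ _ (hN ▸ h) fun z hz => ?_
    exact (abs_le.1
      (LinearMap.IsRightSingularBasis.abs_inner_le_of_mem_tailSubspace hb ⟨j, hj⟩ hz)).2
  · refine T.isSymmetric_dilation.le_eigenvalues hN (W.headGraph b ⟨j, hj⟩) _ _
      (by rw [LinearMap.finrank_headGraph]; exact Nat.lt_succ_self _) ?_
    rintro _ ⟨x, hx, rfl⟩
    rw [T.inner_dilation_apply, WithLp.prod_norm_sq_eq_of_L2]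
    exact LinearMap.IsRightSingularBasis.le_inner_of_polar W hW hTW ⟨j, hj⟩ hx

theorem LinearMap.eigenvalues_dilation_rev (T : E →ₗ[ℝ] F) {N : ℕ}
    (hN : finrank ℝ (WithLp 2 (E × F)) = N) {j : ℕ} (hj : j < finrank ℝ E) (hjN : N - 1 - j < N) :
    T.isSymmetric_dilation.eigenvalues hN ⟨N - 1 - j, hjN⟩ = -T.singularValues j := by
  obtain ⟨b, hb⟩ := T.exists_rightSingularBasis rfl
  obtain ⟨W, hW, hTW⟩ := LinearMap.IsRightSingularBasis.exists_polar hb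
  have hEN : finrank ℝ E ≤ N := by
    rw [← hN, (WithLp.linearEquiv 2 ℝ (E × F)).finrank_eq, finrank_prod]; omega
  refine le_antisymm ?_ ?_
  · refine T.isSymmetric_dilation.eigenvalues_le hN ((-W).headGraph b ⟨j, hj⟩) _ _
      (by rw [LinearMap.finrank_headGraph]; simp only; omega) ?_
    rintro _ ⟨x, hx, rfl⟩
    rw [T.inner_dilation_apply, WithLp.prod_norm_sq_eq_of_L2]
    have := LinearMap.IsRightSingularBasis.le_inner_of_polar W hW hTW ⟨j, hj⟩ hx
    simp at this ⊢
    linarith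
  · have h := LinearMap.le_finrank_tailSubspace (F := F) b ⟨j, hj⟩
    rw [hN] at h
    refine T.isSymmetric_dilation.le_eigenvalues hN
      (LinearMap.tailSubspace F b ⟨j, hj⟩) _ _ (by simp only at h ⊢; omega) fun z hz => ?_
    rw [neg_mul]
    exact (abs_le.1
      (LinearMap.IsRightSingularBasis.abs_inner_le_of_mem_tailSubspace hb ⟨j, hj⟩ hz)).1

end Dilation

/-! ### Perturbation of `p`-th powers of singular values. -/

section PerturbationInequality

/-- Both `t` and `s + d` are convex combinations of `s` and `t + d`, with swapped weights; the two
concavity inequalities add up to the claim. -/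
theorem Real.rpow_add_sub_rpow_le {p s t d : ℝ} (hp : 0 ≤ p) (hp1 : p ≤ 1) (hs : 0 ≤ s)
    (hst : s ≤ t) (hd : 0 ≤ d) : (t + d) ^ p - t ^ p ≤ (s + d) ^ p - s ^ p := by
  rcases hst.eq_or_lt with rfl | hlt
  · exact le_rfl
  have hL : 0 < t + d - s := by linarith
  have hc := Real.concaveOn_rpow hp hp1
  have hs' : s ∈ Set.Ici (0 : ℝ) := hs
  have htd : t + d ∈ Set.Ici (0 : ℝ) := by simp only [Set.mem_Ici]; linarith
  have ha : 0 ≤ d / (t + d - s) := by positivity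
  have hb : 0 ≤ (t - s) / (t + d - s) := div_nonneg (by linarith) hL.le
  have hab : d / (t + d - s) + (t - s) / (t + d - s) = 1 := by field_simp; ring
  have h1 := hc.2 hs' htd ha hb hab
  have h2 := hc.2 hs' htd hb ha (by rw [add_comm, hab])
  have e1 : (d / (t + d - s)) • s + ((t - s) / (t + d - s)) • (t + d) = t := by
    simp only [smul_eq_mul]; field_simp; ring
  have e2 : ((t - s) / (t + d - s)) • s + (d / (t + d - s)) • (t + d) = s + d := by
    simp only [smul_eq_mul]; field_simp; ring
  rw [e1] at h1
  rw [e2] at h2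
  simp only [smul_eq_mul] at h1 h2
  have : (d / (t + d - s)) * (s ^ p + (t + d) ^ p) + (t - s) / (t + d - s) * (s ^ p + (t + d) ^ p)
      = s ^ p + (t + d) ^ p := by rw [← add_mul, hab, one_mul]
  linarith

/-- For interlacing sequences `a` and `b` the intervals between `a j` and `b j` do not overlap. -/
theorem sum_abs_rpow_sub_rpow_le_of_interlace {p : ℝ} (hp : 0 < p) (hp1 : p ≤ 1) (K : ℕ) :
    ∀ {a b : ℕ → ℝ}, (∀ j, 0 ≤ a j) → (∀ j, 0 ≤ b j) → Antitone a → Antitone b →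
    (∀ j, a (j + 1) ≤ b j) → (∀ j, b (j + 1) ≤ a j) →
    ∑ j ∈ Finset.range K, |a j ^ p - b j ^ p| ≤ (∑ j ∈ Finset.range K, |a j - b j|) ^ p ∧
      ∑ j ∈ Finset.range K, |a j - b j| ≤ max (a 0) (b 0) := by
  induction K with
  | zero =>
    intro a b ha _ _ _ _ _
    simp [Real.zero_rpow hp.ne', ha 0]
  | succ K ih =>
    intro a b ha hb ha' hb' hab hba
    obtain ⟨h1, h2⟩ := ih (a := fun j => a (j + 1)) (b := fun j => b (j + 1)) (fun j => ha _)
      (fun j => hb _) (fun i j h => ha' (by omega)) (fun i j h => hb' (by omega))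
      (fun j => hab _) (fun j => hba _)
    rw [Finset.sum_range_succ', Finset.sum_range_succ']
    set S := ∑ j ∈ Finset.range K, |a (j + 1) - b (j + 1)| with hS
    have hS0 : 0 ≤ S := Finset.sum_nonneg fun j _ => abs_nonneg _
    -- The second half of the induction hypothesis places the remaining total length below the
    -- topmost interval.
    have hlo : S ≤ min (a 0) (b 0) := h2.trans (max_le (le_min (ha' zero_le_one) (hab 0))
      (le_min (hba 0) (hb' zero_le_one)))
    have hmm : min (a 0) (b 0) + |a 0 - b 0| = max (a 0) (b 0) := by
      rw [← max_sub_min_eq_abs']; ring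
    refine ⟨?_, by linarith⟩
    -- Sliding the topmost interval down until it starts at `S` can only increase its `p`-th power
    -- increment.
    have h3 : |a 0 ^ p - b 0 ^ p| ≤ (S + |a 0 - b 0|) ^ p - S ^ p := by
      refine le_trans (le_of_eq ?_)
        (Real.rpow_add_sub_rpow_le hp.le hp1 hS0 hlo (abs_nonneg (a 0 - b 0)))
      rw [hmm]
      rcases le_total (a 0) (b 0) with h | h
      · rw [max_eq_right h, min_eq_left h, abs_sub_comm, abs_of_nonneg]
        exact sub_nonneg.2 (Real.rpow_le_rpow (ha 0) h hp.le)
      · rw [max_eq_left h, min_eq_right h, abs_of_nonneg]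
        exact sub_nonneg.2 (Real.rpow_le_rpow (hb 0) h hp.le)
    linarith

variable {E : Type*} [NormedAddCommGroup E] [InnerProductSpace ℝ E]
  {F : Type*} [NormedAddCommGroup F] [InnerProductSpace ℝ F]

/-- `T` composed with the projection onto the span of the members of `b` with index in `S`. -/
noncomputable def LinearMap.truncate {n : ℕ} (T : E →ₗ[ℝ] F) (b : OrthonormalBasis (Fin n) ℝ E)
    (S : Finset (Fin n)) : E →ₗ[ℝ] F :=
  ∑ i ∈ S, (innerₗ E (b i)).smulRight (T (b i))

theorem LinearMap.truncate_apply {n : ℕ} (T : E →ₗ[ℝ] F) (b : OrthonormalBasis (Fin n) ℝ E)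
    (S : Finset (Fin n)) (x : E) : T.truncate b S x = ∑ i ∈ S, inner ℝ (b i) x • T (b i) := by
  simp [LinearMap.truncate, LinearMap.sum_apply]

theorem LinearMap.truncate_univ {n : ℕ} (T : E →ₗ[ℝ] F) (b : OrthonormalBasis (Fin n) ℝ E) :
    T.truncate b Finset.univ = T := by
  ext x
  rw [T.truncate_apply, ← T.apply_eq_sum_orthonormalBasis b x]

variable [FiniteDimensional ℝ E] [FiniteDimensional ℝ F]

theorem LinearMap.IsRightSingularBasis.mul_norm_le {n : ℕ} {T : E →ₗ[ℝ] F}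
    {b : OrthonormalBasis (Fin n) ℝ E} (hb : T.IsRightSingularBasis b) (j : Fin n)
    {x : E} (hx : x ∈ b.spanOn (Finset.Iic j)) : T.singularValues j * ‖x‖ ≤ ‖T x‖ := by
  refine le_of_sq_le_sq ?_ (norm_nonneg _)
  rw [hb.norm_sq_apply, mul_pow, b.norm_sq_eq_sum_inner_sq, Finset.mul_sum]
  refine Finset.sum_le_sum fun i _ => ?_
  by_cases hi : i ≤ j
  · exact mul_le_mul_of_nonneg_right
      (pow_le_pow_left₀ (T.singularValues_nonneg j) (T.singularValues_antitone hi) 2) (sq_nonneg _)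
  · rw [b.inner_eq_zero_of_mem_spanOn hx (by simpa using hi)]
    simp

/-- Interlacing of singular values under a perturbation of rank one. -/
theorem LinearMap.singularValues_succ_le (A B : E →ₗ[ℝ] F) (v : E)
    (h : ∀ x, inner ℝ v x = 0 → A x = B x) (j : ℕ) :
    B.singularValues (j + 1) ≤ A.singularValues j := by
  by_cases hj : j + 1 < finrank ℝ E
  · obtain ⟨b, hb⟩ := B.exists_rightSingularBasis rfl
    set W := b.spanOn (Finset.Iic ⟨j + 1, hj⟩) with hW
    set U := LinearMap.ker (innerₗ E v) with hU
    -- `W` has dimension `j + 2` and `U` has codimension at most one, so dimension `j + 1` is left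
    -- for testing `A`, which equals `B` there.
    have h1 := Submodule.finrank_sup_add_finrank_inf_eq W U
    have h2 := Submodule.finrank_le (W ⊔ U)
    have h3 := (innerₗ E v).finrank_range_add_finrank_ker
    have h4 : finrank ℝ (LinearMap.range (innerₗ E v)) ≤ 1 :=
      (Submodule.finrank_le _).trans (by simp)
    have h5 : finrank ℝ W = j + 2 := by rw [hW, b.finrank_spanOn, Fin.card_Iic]
    refine A.le_singularValues (W ⊓ U) (B.singularValues_nonneg _)
      (by rw [← hU] at h3; omega) fun x hx => ?_
    rw [h x (by simpa [hU] using hx.2)]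
    exact LinearMap.IsRightSingularBasis.mul_norm_le hb ⟨j + 1, hj⟩ hx.1
  · rw [B.singularValues_of_finrank_le (not_lt.1 hj)]
    exact A.singularValues_nonneg j

/-- Each singular value difference occurs at positions `j` and `N - 1 - j` of the dilation spectra.
Restricting `j` below both dimensions keeps the two position sets disjoint. -/
theorem LinearMap.two_mul_sum_abs_singularValues_sub_le (A B : E →ₗ[ℝ] F) {N : ℕ}
    (hN : finrank ℝ (WithLp 2 (E × F)) = N) :
    2 * ∑ j ∈ Finset.range (min (finrank ℝ E) (finrank ℝ F)),
      |A.singularValues j - B.singularValues j| ≤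
    ∑ i, |A.isSymmetric_dilation.eigenvalues hN i - B.isSymmetric_dilation.eigenvalues hN i| := by
  set d := min (finrank ℝ E) (finrank ℝ F) with hd
  have hdN : finrank ℝ E + finrank ℝ F = N := by
    rw [← hN, (WithLp.linearEquiv 2 ℝ (E × F)).finrank_eq, finrank_prod]
  set g : Fin N → ℝ := fun i =>
    |A.isSymmetric_dilation.eigenvalues hN i - B.isSymmetric_dilation.eigenvalues hN i| with hg
  set h : ℕ → ℝ := fun i => if hi : i < N then g ⟨i, hi⟩ else 0 with hh
  have hh0 : ∀ i, 0 ≤ h i := fun i => by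
    simp only [hh]; split_ifs
    · exact abs_nonneg _
    · exact le_rfl
  have hsum : ∑ i, g i = ∑ i ∈ Finset.range N, h i := by
    rw [Finset.sum_range]
    exact Finset.sum_congr rfl fun i _ => by simp [hh]
  have h1 : ∀ j < d, h j = |A.singularValues j - B.singularValues j| := fun j hj => by
    have hjN : j < N := by omega
    simp only [hh, dif_pos hjN, hg]
    rw [A.eigenvalues_dilation hN (by omega), B.eigenvalues_dilation hN (by omega)]
  have h2 : ∀ j < d, h (N - 1 - j) = |A.singularValues j - B.singularValues j| := fun j hj => by
    have hjN : N - 1 - j < N := by omega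
    simp only [hh, dif_pos hjN, hg]
    rw [A.eigenvalues_dilation_rev hN (by omega), B.eigenvalues_dilation_rev hN (by omega),
      ← abs_neg]
    congr 1
    ring
  have hinj : Set.InjOn (fun j => N - 1 - j) (Finset.range d : Set ℕ) := fun i hi j hj hij => by
    simp only [Finset.coe_range, Set.mem_Iio] at hi hj hij
    omega
  have hdisj : Disjoint (Finset.range d) ((Finset.range d).image fun j => N - 1 - j) := by
    rw [Finset.disjoint_left]
    intro i hi hi'
    simp only [Finset.mem_image, Finset.mem_range] at hi hi'
    obtain ⟨j, hj, rfl⟩ := hi'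
    omega
  calc _ = ∑ i ∈ Finset.range d ∪ (Finset.range d).image (fun j => N - 1 - j), h i := by
        rw [Finset.sum_union hdisj, Finset.sum_image hinj, two_mul]
        congr 1 <;> refine Finset.sum_congr rfl fun j hj => ?_
        · rw [h1 j (Finset.mem_range.1 hj)]
        · rw [h2 j (Finset.mem_range.1 hj)]
    _ ≤ _ := by
        rw [hsum]
        refine Finset.sum_le_sum_of_subset_of_nonneg ?_ fun i _ _ => hh0 i
        intro i hi
        simp only [Finset.mem_union, Finset.mem_image, Finset.mem_range] at hi ⊢
        rcases hi with hi | ⟨j, hj, rfl⟩ <;> omega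

theorem LinearMap.singularValues_eq_zero_of_min_le (A : E →ₗ[ℝ] F) {j : ℕ}
    (hj : min (finrank ℝ E) (finrank ℝ F) ≤ j) : A.singularValues j = 0 := by
  rw [A.singularValues_eq_zero_iff_le_finrank_range]
  refine le_trans (le_min ?_ (Submodule.finrank_le _)) hj
  exact A.finrank_range_le

/-- Mirsky's inequality for a perturbation of rank one. -/
theorem LinearMap.sum_abs_singularValues_sub_le (A B : E →ₗ[ℝ] F) (v : E) (hv : ‖v‖ = 1) (w : F)
    (h : ∀ x, B x = A x + inner ℝ v x • w) (K : ℕ) :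
    ∑ j ∈ Finset.range K, |A.singularValues j - B.singularValues j| ≤ ‖w‖ := by
  rcases eq_or_ne w 0 with rfl | hw
  · have : A = B := by ext x; simp [h]
    simp [this]
  have hw' : 0 < ‖w‖ := norm_pos_iff.2 hw
  set u : F := ‖w‖⁻¹ • w with hu
  have hun : ‖u‖ = 1 := by rw [hu, norm_smul, norm_inv, norm_norm, inv_mul_cancel₀ hw'.ne']
  have hwu : w = ‖w‖ • u := by rw [hu, smul_smul, mul_inv_cancel₀ hw'.ne', one_smul]
  set z : WithLp 2 (E × F) := WithLp.toLp 2 (v, u) with hz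
  have hzz : inner ℝ z z = (2 : ℝ) := by
    rw [WithLp.prod_inner_apply, real_inner_self_eq_norm_sq, real_inner_self_eq_norm_sq]
    simp [hz, hv, hun]; norm_num
  set P : WithLp 2 (E × F) →ₗ[ℝ] WithLp 2 (E × F) := (rankOne ℝ z z).toLinearMap with hP
  have hPx : ∀ x y, inner ℝ (P x) y = inner ℝ z x * inner ℝ z y := fun x y => by
    simp [hP, rankOne_apply, inner_smul_left]
  -- `T` is a common upper bound of both dilations: its form exceeds theirs by `‖w‖ / 2` times the
  -- square of `⟨v, x⟩ + ⟨u, y⟩` for `A`, and of `⟨v, x⟩ - ⟨u, y⟩` for `B`. Its trace is `‖w‖`, as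
  -- `‖z‖ ^ 2 = 2`.
  set T := A.dilation + (‖w‖ / 2) • P with hT
  have hTs : T.IsSymmetric := by
    intro x y
    rw [hT, LinearMap.add_apply, LinearMap.add_apply, inner_add_left, inner_add_right,
      A.isSymmetric_dilation, LinearMap.smul_apply, LinearMap.smul_apply, inner_smul_left,
      inner_smul_right, hPx, real_inner_comm (P y), hPx, mul_comm (inner ℝ z y)]
    simp
  have hTx : ∀ x, inner ℝ (T x) x = 2 * inner ℝ (A x.fst) x.snd +
      ‖w‖ / 2 * (inner ℝ v x.fst + inner ℝ u x.snd) ^ 2 := fun x => by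
    rw [hT, LinearMap.add_apply, inner_add_left, A.inner_dilation_apply, LinearMap.smul_apply,
      inner_smul_left, hPx, WithLp.prod_inner_apply]
    simp [hz, sq]
  have htr : LinearMap.trace ℝ _ T = ‖w‖ := by
    rw [hT, map_add, A.trace_dilation, map_smul, hP, trace_rankOne, hzz]
    simp
  have hA : ∀ x, inner ℝ (A.dilation x) x ≤ inner ℝ (T x) x := fun x => by
    rw [hTx, A.inner_dilation_apply]
    have : 0 ≤ ‖w‖ / 2 * (inner ℝ v x.fst + inner ℝ u x.snd) ^ 2 := by positivity
    linarith
  have hB : ∀ x, inner ℝ (B.dilation x) x ≤ inner ℝ (T x) x := fun x => by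
    rw [hTx, B.inner_dilation_apply, h, inner_add_left, inner_smul_left, hwu, inner_smul_left,
      ← hwu]
    have : 0 ≤ ‖w‖ / 2 * (inner ℝ v x.fst - inner ℝ u x.snd) ^ 2 := by positivity
    simp only [conj_trivial]
    nlinarith
  have key := (A.two_mul_sum_abs_singularValues_sub_le B rfl).trans
    (A.isSymmetric_dilation.sum_abs_eigenvalues_sub_le B.isSymmetric_dilation hTs rfl hA hB)
  rw [htr, A.trace_dilation, B.trace_dilation] at key
  refine le_trans ?_ (show ∑ j ∈ Finset.range (min (finrank ℝ E) (finrank ℝ F)),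
      |A.singularValues j - B.singularValues j| ≤ ‖w‖ by linarith)
  rw [← Finset.sum_filter_ne_zero]
  refine Finset.sum_le_sum_of_subset_of_nonneg (fun j hj => ?_) fun _ _ _ => abs_nonneg _
  rw [Finset.mem_filter] at hj
  replace hj := hj.2
  rw [Finset.mem_range]
  by_contra hj'
  rw [A.singularValues_eq_zero_of_min_le (not_lt.1 hj'),
    B.singularValues_eq_zero_of_min_le (not_lt.1 hj')] at hj
  simp at hj

theorem LinearMap.sum_abs_singularValues_rpow_sub_le_of_rankOne {p : ℝ} (hp : 0 < p) (hp1 : p ≤ 1)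
    (A B : E →ₗ[ℝ] F) (v : E) (hv : ‖v‖ = 1) (w : F)
    (h : ∀ x, B x = A x + inner ℝ v x • w) (K : ℕ) :
    ∑ j ∈ Finset.range K, |A.singularValues j ^ p - B.singularValues j ^ p| ≤ ‖w‖ ^ p := by
  have hAB : ∀ x, inner ℝ v x = 0 → A x = B x := fun x hx => by simp [h, hx]
  refine (sum_abs_rpow_sub_rpow_le_of_interlace hp hp1 K A.singularValues_nonneg
    B.singularValues_nonneg A.singularValues_antitone B.singularValues_antitone
    (B.singularValues_succ_le A v fun x hx => (hAB x hx).symm)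
    (A.singularValues_succ_le B v hAB)).1.trans ?_
  exact Real.rpow_le_rpow (Finset.sum_nonneg fun _ _ => abs_nonneg _)
    (A.sum_abs_singularValues_sub_le B v hv w h K) hp.le

theorem LinearMap.IsRightSingularBasis.norm_apply {n : ℕ} {T : E →ₗ[ℝ] F}
    {b : OrthonormalBasis (Fin n) ℝ E} (hb : T.IsRightSingularBasis b) (i : Fin n) :
    ‖T (b i)‖ = T.singularValues i := by
  have h := hb i i
  rw [if_pos rfl, real_inner_self_eq_norm_sq] at h
  exact (sq_eq_sq₀ (norm_nonneg _) (T.singularValues_nonneg _)).1 h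

/-- The perturbation inequality for `p`-th powers of singular values, `0 < p ≤ 1`. -/
theorem LinearMap.sum_abs_singularValues_rpow_sub_le {p : ℝ} (hp : 0 < p) (hp1 : p ≤ 1)
    (A B : E →ₗ[ℝ] F) {n : ℕ} (hn : finrank ℝ E = n) (K : ℕ) :
    ∑ j ∈ Finset.range K, |A.singularValues j ^ p - B.singularValues j ^ p| ≤
      ∑ j ∈ Finset.range n, (A - B).singularValues j ^ p := by
  obtain ⟨b, hb'⟩ := (A - B).exists_rightSingularBasis hn
  have hb : (A - B).IsRightSingularBasis b := hb'
  -- Adding one right singular vector `b i` of `A - B` is a rank-one change with `w = (A - B) (b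
  -- i)`, whose norm is the corresponding singular value.
  have key : ∀ S : Finset (Fin n),
      ∑ j ∈ Finset.range K,
        |(B + (A - B).truncate b S).singularValues j ^ p - B.singularValues j ^ p| ≤
      ∑ i ∈ S, (A - B).singularValues i ^ p := fun S => by
    induction S using Finset.induction_on with
    | empty => simp [LinearMap.truncate]
    | insert i S hi ih =>
      have h1 := LinearMap.sum_abs_singularValues_rpow_sub_le_of_rankOne hp hp1
        (B + (A - B).truncate b S) (B + (A - B).truncate b (insert i S)) (b i)
        (b.orthonormal.1 i) ((A - B) (b i)) (fun x => by
          simp only [LinearMap.add_apply, LinearMap.truncate_apply, Finset.sum_insert hi]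
          abel) K
      rw [hb.norm_apply] at h1
      rw [Finset.sum_insert hi]
      refine le_trans ?_ (add_le_add h1 ih)
      rw [← Finset.sum_add_distrib]
      refine Finset.sum_le_sum fun j _ => ?_
      rw [abs_sub_comm ((B + (A - B).truncate b S).singularValues j ^ p)]
      exact abs_sub_le _ _ _
  have h := key Finset.univ
  rw [LinearMap.truncate_univ, add_sub_cancel] at h
  rwa [Finset.sum_range fun j => (A - B).singularValues j ^ p]

end PerturbationInequality

/-! ### Block estimates for decreasing sequences. -/

section Sequences

theorem sum_rpow_le_rpow_sum {ι : Type*} (s : Finset ι) {f : ι → ℝ} (hf : ∀ i, 0 ≤ f i) {a : ℝ}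
    (ha : 1 ≤ a) : ∑ i ∈ s, f i ^ a ≤ (∑ i ∈ s, f i) ^ a := by
  classical
  induction s using Finset.induction_on with
  | empty => simp [Real.zero_rpow (by linarith : a ≠ 0)]
  | insert i s hi ih =>
    rw [Finset.sum_insert hi, Finset.sum_insert hi]
    exact (add_le_add_right ih _).trans
      (Real.add_rpow_le_rpow_add (hf i) (Finset.sum_nonneg fun i _ => hf i) ha)

theorem sum_range_sum_Ico {M : Type*} [AddCommMonoid M] (f : ℕ → M) (a s N : ℕ) :
    ∑ i ∈ Finset.range N, ∑ j ∈ Finset.Ico (a + i * s) (a + (i + 1) * s), f j =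
      ∑ j ∈ Finset.Ico a (a + N * s), f j := by
  induction N with
  | zero => simp
  | succ N ih =>
    rw [Finset.sum_range_succ, ih, Finset.sum_Ico_consecutive] <;> simp [add_mul, ← add_assoc]

/-- Both blocks are compared with `τ (a + s)`, an upper bound for the later block and a lower bound
for the earlier one. -/
theorem sum_sq_Ico_rpow_le {τ : ℕ → ℝ} (hτ : ∀ j, 0 ≤ τ j) (hτ' : Antitone τ) {p q : ℝ}
    (hp : 0 < p) (hq : 0 < q) (a : ℕ) {s : ℕ} (hs : 0 < s) :
    (∑ j ∈ Finset.Ico (a + s) (a + s + s), τ j ^ 2) ^ (q / 2) ≤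
      (s : ℝ) ^ (q / 2 - q / p) * (∑ j ∈ Finset.Ico a (a + s), τ j ^ p) ^ (q / p) := by
  have hs' : (0 : ℝ) < s := by exact_mod_cast hs
  have ht := hτ (a + s)
  have h1 : ∑ j ∈ Finset.Ico (a + s) (a + s + s), τ j ^ 2 ≤ s * τ (a + s) ^ 2 := by
    refine (Finset.sum_le_card_nsmul _ _ (τ (a + s) ^ 2) fun j hj => ?_).trans (by simp)
    exact pow_le_pow_left₀ (hτ j) (hτ' (Finset.mem_Ico.1 hj).1) 2
  have h2 : s * τ (a + s) ^ p ≤ ∑ j ∈ Finset.Ico a (a + s), τ j ^ p := by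
    refine le_trans (by simp) (Finset.card_nsmul_le_sum _ _ (τ (a + s) ^ p) fun j hj => ?_)
    exact Real.rpow_le_rpow ht (hτ' (Finset.mem_Ico.1 hj).2.le) hp.le
  have e1 : (s * τ (a + s) ^ 2) ^ (q / 2) = (s : ℝ) ^ (q / 2) * τ (a + s) ^ q := by
    rw [Real.mul_rpow hs'.le (sq_nonneg _), ← Real.rpow_natCast, ← Real.rpow_mul ht]
    congr 2; push_cast; ring
  have e2 : (s * τ (a + s) ^ p) ^ (q / p) = (s : ℝ) ^ (q / p) * τ (a + s) ^ q := by
    rw [Real.mul_rpow hs'.le (Real.rpow_nonneg ht _), ← Real.rpow_mul ht]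
    congr 2; field_simp
  calc _ ≤ (s * τ (a + s) ^ 2) ^ (q / 2) :=
        Real.rpow_le_rpow (Finset.sum_nonneg fun _ _ => sq_nonneg _) h1 (by positivity)
    _ = (s : ℝ) ^ (q / 2 - q / p) * (s * τ (a + s) ^ p) ^ (q / p) := by
        rw [e1, e2, ← mul_assoc, ← Real.rpow_add hs']
        congr 2; ring
    _ ≤ _ := by
        refine mul_le_mul_of_nonneg_left ?_ (Real.rpow_nonneg hs'.le _)
        exact Real.rpow_le_rpow (mul_nonneg hs'.le (Real.rpow_nonneg ht _)) h2 (by positivity)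

/-- The power mean inequality with exponent `2 / p`. -/
theorem sum_rpow_rpow_le {τ : ℕ → ℝ} (hτ : ∀ j, 0 ≤ τ j) {p q : ℝ}
    (hp : 0 < p) (hp2 : p ≤ 2) (hq : 0 < q) {r : ℕ} (hr : 0 < r) :
    (∑ j ∈ Finset.range r, τ j ^ p) ^ (q / p) ≤
      (r : ℝ) ^ (q / p - q / 2) * (∑ j ∈ Finset.range r, τ j ^ 2) ^ (q / 2) := by
  have hr' : (0 : ℝ) < r := by exact_mod_cast hr
  have hpos : 0 ≤ ∑ j ∈ Finset.range r, τ j ^ p :=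
    Finset.sum_nonneg fun j _ => Real.rpow_nonneg (hτ j) _
  have h := Real.rpow_sum_le_const_mul_sum_rpow_of_nonneg (Finset.range r)
    (f := fun j => τ j ^ p) (p := 2 / p) (by rw [le_div_iff₀ hp]; linarith)
    (fun j _ => Real.rpow_nonneg (hτ j) _)
  have e : ∀ j, (τ j ^ p) ^ (2 / p) = τ j ^ 2 := fun j => by
    rw [← Real.rpow_mul (hτ j), mul_div_cancel₀ _ hp.ne', Real.rpow_two]
  simp only [e, Finset.card_range] at h
  have h' := Real.rpow_le_rpow (Real.rpow_nonneg hpos _) h (by positivity : 0 ≤ q / 2)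
  rw [← Real.rpow_mul hpos, Real.mul_rpow (Real.rpow_nonneg hr'.le _)
    (Finset.sum_nonneg fun _ _ => sq_nonneg _), ← Real.rpow_mul hr'.le] at h'
  have e1 : 2 / p * (q / 2) = q / p := by field_simp
  have e2 : (2 / p - 1) * (q / 2) = q / p - q / 2 := by field_simp
  rwa [e1, e2] at h'

/-- If the head of `τ` dominates its tail in `ℓ_p`, then the blocks of length `s` of the tail are
small in `ℓ_2` relative to the head. -/
theorem sum_blocks_le {τ : ℕ → ℝ} (hτ : ∀ j, 0 ≤ τ j) (hτ' : Antitone τ) {p q : ℝ}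
    (hp : 0 < p) (hp2 : p ≤ 2) (hpq : p ≤ q) {r s : ℕ} (hr : 0 < r) (hs : 0 < s)
    (hnull : ∀ N, ∑ j ∈ Finset.Ico r N, τ j ^ p ≤ ∑ j ∈ Finset.range r, τ j ^ p) (N : ℕ) :
    ∑ i ∈ Finset.range N,
      (∑ j ∈ Finset.Ico (r + s + i * s) (r + s + (i + 1) * s), τ j ^ 2) ^ (q / 2) ≤
    ((s : ℝ) / r) ^ (q / 2 - q / p) * (∑ j ∈ Finset.range r, τ j ^ 2) ^ (q / 2) := by
  have hq : 0 < q := hp.trans_le hpq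
  have hr' : (0 : ℝ) < r := by exact_mod_cast hr
  have hs' : (0 : ℝ) < s := by exact_mod_cast hs
  have hpow : ∀ t : Finset ℕ, 0 ≤ ∑ j ∈ t, τ j ^ p := fun t =>
    Finset.sum_nonneg fun j _ => Real.rpow_nonneg (hτ j) _
  calc _ ≤ ∑ i ∈ Finset.range N, (s : ℝ) ^ (q / 2 - q / p) *
        (∑ j ∈ Finset.Ico (r + i * s) (r + (i + 1) * s), τ j ^ p) ^ (q / p) := by
        refine Finset.sum_le_sum fun i _ => ?_
        have h := sum_sq_Ico_rpow_le hτ hτ' hp hq (r + i * s) hs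
        rw [show r + i * s + s = r + (i + 1) * s by ring] at h
        rwa [show r + s + i * s = r + (i + 1) * s by ring,
          show r + s + (i + 1) * s = r + (i + 1) * s + s by ring]
    _ ≤ (s : ℝ) ^ (q / 2 - q / p) * (∑ j ∈ Finset.range r, τ j ^ p) ^ (q / p) := by
        rw [← Finset.mul_sum]
        refine mul_le_mul_of_nonneg_left ?_ (Real.rpow_nonneg hs'.le _)
        -- Here `p ≤ q` enters: for `q / p ≥ 1` the block powers sum to at most the power of the
        -- whole tail sum.
        refine (sum_rpow_le_rpow_sum _ (fun i => hpow _) ((one_le_div hp).2 hpq)).trans ?_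
        rw [sum_range_sum_Ico]
        exact Real.rpow_le_rpow (hpow _) (hnull _) (by positivity)
    _ ≤ _ := by
        refine (mul_le_mul_of_nonneg_left (sum_rpow_rpow_le hτ hp hp2 hq hr)
          (Real.rpow_nonneg hs'.le _)).trans (le_of_eq ?_)
        rw [← mul_assoc, Real.div_rpow hs'.le hr'.le, div_eq_mul_inv (_ ^ _) (_ ^ _),
          ← Real.rpow_neg hr'.le, neg_sub]

end Sequences

/-! ### Cutting a map along its singular value decomposition. -/

section SingularParts

variable {E : Type*} [NormedAddCommGroup E] [InnerProductSpace ℝ E]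
  {F : Type*} [NormedAddCommGroup F] [InnerProductSpace ℝ F]

/-- The part of `T` that belongs to the singular values with index in `[a, c)`. -/
noncomputable def LinearMap.singularPart {n : ℕ} (T : E →ₗ[ℝ] F) (b : OrthonormalBasis (Fin n) ℝ E)
    (a c : ℕ) : E →ₗ[ℝ] F :=
  T.truncate b (Finset.univ.filter fun i => a ≤ i.val ∧ i.val < c)

theorem LinearMap.singularPart_add {n : ℕ} (T : E →ₗ[ℝ] F) (b : OrthonormalBasis (Fin n) ℝ E)
    {a c d : ℕ} (hac : a ≤ c) (hcd : c ≤ d) :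
    T.singularPart b a c + T.singularPart b c d = T.singularPart b a d := by
  simp only [LinearMap.singularPart, LinearMap.truncate]
  rw [← Finset.sum_union]
  · refine Finset.sum_congr ?_ fun _ _ => rfl
    ext i
    simp only [Finset.mem_union, Finset.mem_filter, Finset.mem_univ, true_and]
    omega
  · rw [Finset.disjoint_filter]
    intro i _ hi
    omega

theorem LinearMap.singularPart_add_sum {n : ℕ} (T : E →ₗ[ℝ] F) (b : OrthonormalBasis (Fin n) ℝ E)
    (a s N : ℕ) : T.singularPart b 0 a +
      ∑ i ∈ Finset.range N, T.singularPart b (a + i * s) (a + (i + 1) * s) =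
        T.singularPart b 0 (a + N * s) := by
  induction N with
  | zero => simp
  | succ N ih =>
    rw [Finset.sum_range_succ, ← add_assoc, ih, T.singularPart_add b (Nat.zero_le _)]
    exact Nat.add_le_add_left (Nat.mul_le_mul_right _ (Nat.le_succ _)) _

theorem LinearMap.singularPart_eq_self {n : ℕ} (T : E →ₗ[ℝ] F) (b : OrthonormalBasis (Fin n) ℝ E)
    {c : ℕ} (hc : n ≤ c) : T.singularPart b 0 c = T := by
  rw [LinearMap.singularPart, Finset.filter_true_of_mem, T.truncate_univ]
  intro i _
  omega

variable [FiniteDimensional ℝ F]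

theorem LinearMap.finrank_range_singularPart_le {n : ℕ} (T : E →ₗ[ℝ] F)
    (b : OrthonormalBasis (Fin n) ℝ E) (a c : ℕ) :
    finrank ℝ (LinearMap.range (T.singularPart b a c)) ≤ c - a := by
  set S : Finset (Fin n) := Finset.univ.filter fun i => a ≤ i.val ∧ i.val < c with hS
  have hle : LinearMap.range (T.singularPart b a c) ≤
      Submodule.span ℝ (Set.range fun i : S => T (b i)) := by
    rintro _ ⟨x, rfl⟩
    rw [LinearMap.singularPart, LinearMap.truncate_apply]
    exact Submodule.sum_mem _ fun i hi =>
      Submodule.smul_mem _ _ (Submodule.subset_span ⟨⟨i, hi⟩, rfl⟩)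
  refine (Submodule.finrank_mono hle).trans ((finrank_range_le_card _).trans ?_)
  rw [Fintype.card_coe, ← Nat.card_Ico]
  refine Finset.card_le_card_of_injOn (fun i => i.val) (fun i hi => ?_) Fin.val_injective.injOn
  simpa [hS] using hi

variable [FiniteDimensional ℝ E]

/-- If `X` has rank at most `r` and `Y` has no larger Schatten `p`-norm than `X`, the head of the
singular values of `X - Y` dominates the tail. -/
theorem LinearMap.sum_Ico_singularValues_rpow_le {p : ℝ} (hp : 0 < p) (hp1 : p ≤ 1)
    (X Y : E →ₗ[ℝ] F) {n : ℕ} (hn : finrank ℝ E = n) {r : ℕ}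
    (hX : finrank ℝ (LinearMap.range X) ≤ r)
    (hXY : ∑ j ∈ Finset.range n, Y.singularValues j ^ p ≤
      ∑ j ∈ Finset.range n, X.singularValues j ^ p) (N : ℕ) :
    ∑ j ∈ Finset.Ico r N, (X - Y).singularValues j ^ p ≤
      ∑ j ∈ Finset.range r, (X - Y).singularValues j ^ p := by
  have hX0 : ∀ j, r ≤ j → X.singularValues j ^ p = 0 := fun j hj => by
    rw [X.singularValues_eq_zero_iff_le_finrank_range.2 (hX.trans hj), Real.zero_rpow hp.ne']
  have hnn : ∀ (T : E →ₗ[ℝ] F) j, 0 ≤ T.singularValues j ^ p := fun T j =>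
    Real.rpow_nonneg (T.singularValues_nonneg j) _
  rcases lt_or_ge N r with hN | hN
  · rw [Finset.Ico_eq_empty (by omega), Finset.sum_empty]
    exact Finset.sum_nonneg fun j _ => hnn _ j
  -- The perturbation is taken from `X - Y` to `X`, so the error term is `Y` itself.
  have h := X.sum_abs_singularValues_rpow_sub_le hp hp1 (X - Y) hn N
  rw [sub_sub_cancel] at h
  have h1 : ∑ j ∈ Finset.range n, X.singularValues j ^ p ≤
      ∑ j ∈ Finset.range r, X.singularValues j ^ p := by
    rw [← Finset.sum_filter_ne_zero]
    refine Finset.sum_le_sum_of_subset_of_nonneg (fun j hj => ?_) fun j _ _ => hnn _ j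
    rw [Finset.mem_range]
    by_contra hj'
    exact (Finset.mem_filter.1 hj).2 (hX0 j (not_lt.1 hj'))
  rw [← Finset.sum_range_add_sum_Ico _ hN] at h
  have h2 : ∑ j ∈ Finset.range r, (X.singularValues j ^ p - (X - Y).singularValues j ^ p) ≤
      ∑ j ∈ Finset.range r, |X.singularValues j ^ p - (X - Y).singularValues j ^ p| :=
    Finset.sum_le_sum fun j _ => le_abs_self _
  have h3 : ∑ j ∈ Finset.Ico r N, (X - Y).singularValues j ^ p =
      ∑ j ∈ Finset.Ico r N, |X.singularValues j ^ p - (X - Y).singularValues j ^ p| :=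
    Finset.sum_congr rfl fun j hj => by
      rw [hX0 j (Finset.mem_Ico.1 hj).1, zero_sub, abs_neg, abs_of_nonneg (hnn _ j)]
  rw [Finset.sum_sub_distrib] at h2
  linarith

/-- Both sides are the trace of `T* T`, so any orthonormal basis may be used. For a singular part
this avoids identifying its individual singular values. -/
theorem LinearMap.sum_singularValues_sq {n : ℕ} (T : E →ₗ[ℝ] F) (b : OrthonormalBasis (Fin n) ℝ E) :
    ∑ j ∈ Finset.range n, T.singularValues j ^ 2 = ∑ i, ‖T (b i)‖ ^ 2 := by
  have hn : finrank ℝ E = n := by rw [finrank_eq_card_basis b.toBasis, Fintype.card_fin]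
  have h := T.isSymmetric_adjoint_comp_self.trace_eq_sum_eigenvalues hn
  rw [LinearMap.trace_eq_sum_inner _ b] at h
  rw [Finset.sum_range, Finset.sum_congr rfl fun i _ => T.sq_singularValues_fin hn i]
  simp only [RCLike.ofReal_real_eq_id, id_eq] at h
  rw [← h]
  refine Finset.sum_congr rfl fun i _ => ?_
  rw [LinearMap.comp_apply, LinearMap.adjoint_inner_right, real_inner_self_eq_norm_sq]

theorem LinearMap.IsRightSingularBasis.sum_singularValues_singularPart_sq {n : ℕ} {T : E →ₗ[ℝ] F}
    {b : OrthonormalBasis (Fin n) ℝ E} (hb : T.IsRightSingularBasis b) (a c : ℕ) :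
    ∑ j ∈ Finset.range n, (T.singularPart b a c).singularValues j ^ 2 =
      ∑ j ∈ Finset.Ico a c, T.singularValues j ^ 2 := by
  have hn : finrank ℝ E = n := by rw [finrank_eq_card_basis b.toBasis, Fintype.card_fin]
  rw [LinearMap.sum_singularValues_sq _ b]
  have h1 : ∀ i : Fin n, ‖T.singularPart b a c (b i)‖ ^ 2 =
      if a ≤ i.val ∧ i.val < c then T.singularValues i ^ 2 else 0 := fun i => by
    rw [LinearMap.singularPart, LinearMap.truncate_apply]
    simp only [OrthonormalBasis.inner_eq_ite, ite_smul, one_smul, zero_smul, Finset.sum_ite_eq',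
      Finset.mem_filter, Finset.mem_univ, true_and]
    split_ifs
    · rw [hb.norm_apply]
    · simp
  rw [Finset.sum_congr rfl fun i _ => h1 i,
    Fin.sum_univ_eq_sum_range (fun j => if a ≤ j ∧ j < c then T.singularValues j ^ 2 else 0) n,
    ← Finset.sum_filter]
  refine Finset.sum_subset (fun j hj => ?_) fun j hj hj' => ?_
  · simpa using (Finset.mem_filter.1 hj).2
  · rw [Finset.mem_Ico] at hj
    simp only [Finset.mem_filter, Finset.mem_range, hj, and_self, and_true, not_lt] at hj'
    rw [T.singularValues_of_finrank_le (hn ▸ hj')]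
    simp

end SingularParts

/-! ### Restricted uniform boundedness and the kernel of `𝒜`. -/

section Matrices

variable {m n L : ℕ}

theorem schattenNorm_rpow_eq {p : ℝ} (hp : 0 < p) (s : ℝ) (X : Matrix (Fin m) (Fin n) ℝ) :
    schattenNorm p X ^ s =
      (∑ j ∈ Finset.range n, (Matrix.toEuclideanLin X).singularValues j ^ p) ^ (s / p) := by
  have hnn : ∀ j, 0 ≤ (Matrix.toEuclideanLin X).singularValues j :=
    (Matrix.toEuclideanLin X).singularValues_nonneg
  have h : ∑ j ∈ Finset.range (min m n), |matrixSingularValue X j| ^ p =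
      ∑ j ∈ Finset.range n, (Matrix.toEuclideanLin X).singularValues j ^ p := by
    simp only [matrixSingularValue, abs_of_nonneg (hnn _)]
    refine Finset.sum_subset (Finset.range_mono (min_le_right _ _)) fun j _ hj => ?_
    rw [LinearMap.singularValues_eq_zero_of_min_le, Real.zero_rpow hp.ne']
    rw [finrank_euclideanSpace_fin, finrank_euclideanSpace_fin, min_comm]
    exact not_lt.1 fun h => hj (Finset.mem_range.2 h)
  rw [schattenNorm, h, ← Real.rpow_mul (Finset.sum_nonneg fun j _ => Real.rpow_nonneg (hnn j) _),
    one_div_mul_eq_div]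

theorem lqNorm_rpow_self {q : ℝ} (hq : 0 < q) (z : Fin L → ℝ) :
    lqNorm q z ^ q = ∑ j, |z j| ^ q := by
  rw [lqNorm, ← Real.rpow_mul (Finset.sum_nonneg fun j _ => Real.rpow_nonneg (abs_nonneg _) _),
    one_div_mul_cancel hq.ne', Real.rpow_one]

/-- Subadditivity of `t ^ q` for `q ≤ 1`, coordinate by coordinate. -/
theorem lqNorm_sum_rpow_le {q : ℝ} (hq : 0 < q) (hq1 : q ≤ 1) {ι : Type*} (s : Finset ι)
    (z : ι → Fin L → ℝ) : lqNorm q (∑ i ∈ s, z i) ^ q ≤ ∑ i ∈ s, lqNorm q (z i) ^ q := by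
  classical
  simp only [lqNorm_rpow_self hq]
  induction s using Finset.induction_on with
  | empty => simp [Real.zero_rpow hq.ne']
  | insert i s hi ih =>
    rw [Finset.sum_insert hi, Finset.sum_insert hi]
    refine le_trans ?_ (add_le_add_right ih _)
    rw [← Finset.sum_add_distrib]
    refine Finset.sum_le_sum fun j _ => ?_
    exact (Real.rpow_le_rpow (abs_nonneg _) (abs_add_le _ _) hq.le).trans
      (Real.rpow_add_le_add_rpow (abs_nonneg _) (abs_nonneg _) hq.le hq1)

theorem lqNorm_neg (q : ℝ) (z : Fin L → ℝ) : lqNorm q (-z) = lqNorm q z := by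
  simp [lqNorm]

theorem rank_eq_finrank_range_toEuclideanLin (X : Matrix (Fin m) (Fin n) ℝ) :
    X.rank = finrank ℝ (LinearMap.range (Matrix.toEuclideanLin X)) := by
  rw [X.rank_eq_finrank_range_toLin (PiLp.basisFun 2 ℝ (Fin m)) (PiLp.basisFun 2 ℝ (Fin n)),
    ← Matrix.toLpLin_eq_toLin]

/-- Restricted uniform boundedness for the linear map of a matrix, the zero map included. -/
theorem LqRUB.bounds {𝒜 : Matrix (Fin m) (Fin n) ℝ →ₗ[ℝ] (Fin L → ℝ)} {q : ℝ} {N : ℕ} {C₁ C₂ : ℝ}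
    (h : LqRUB 𝒜 q N C₁ C₂) (hq : 0 < q)
    (T : EuclideanSpace ℝ (Fin n) →ₗ[ℝ] EuclideanSpace ℝ (Fin m))
    (hT : finrank ℝ (LinearMap.range T) ≤ N) :
    C₁ * (∑ j ∈ Finset.range n, T.singularValues j ^ 2) ^ (q / 2) ≤
        lqNorm q (𝒜 (Matrix.toEuclideanLin.symm T)) ^ q / L ∧
      lqNorm q (𝒜 (Matrix.toEuclideanLin.symm T)) ^ q / L ≤
        C₂ * (∑ j ∈ Finset.range n, T.singularValues j ^ 2) ^ (q / 2) := by
  have hS : schattenNorm 2 (Matrix.toEuclideanLin.symm T) ^ q =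
      (∑ j ∈ Finset.range n, T.singularValues j ^ 2) ^ (q / 2) := by
    rw [schattenNorm_rpow_eq two_pos, LinearEquiv.apply_symm_apply]
    simp only [Real.rpow_two]
  rcases eq_or_ne T 0 with rfl | hT0
  · simp [lqNorm_rpow_self hq, Real.zero_rpow hq.ne', Real.zero_rpow (half_pos hq).ne']
  · have := h (Matrix.toEuclideanLin.symm T) (by simpa using hT0)
      (by rwa [rank_eq_finrank_range_toEuclideanLin, LinearEquiv.apply_symm_apply])
    rwa [hS] at this

/-- Under restricted uniform boundedness, no nonzero matrix in the kernel of `𝒜` has its singular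
values dominated by the first `r` of them. -/
theorem LqRUB.eq_zero_of_head_dominates {𝒜 : Matrix (Fin m) (Fin n) ℝ →ₗ[ℝ] (Fin L → ℝ)} {r s : ℕ}
    (hr : 0 < r) (hs : 0 < s) {p q : ℝ} (hp : 0 < p) (hpq : p ≤ q) (hq : q ≤ 1) {C₁ C₂ : ℝ}
    (hC₁ : 0 < C₁) (h : LqRUB 𝒜 q (s + r) C₁ C₂)
    (hC : C₂ / C₁ < ((s : ℝ) / r) ^ ((1 / p - 1 / 2) * q))
    (T : EuclideanSpace ℝ (Fin n) →ₗ[ℝ] EuclideanSpace ℝ (Fin m))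
    (hT : 𝒜 (Matrix.toEuclideanLin.symm T) = 0)
    (hnull : ∀ N, ∑ j ∈ Finset.Ico r N, T.singularValues j ^ p ≤
      ∑ j ∈ Finset.range r, T.singularValues j ^ p) : T = 0 := by
  have hq0 : 0 < q := hp.trans_le hpq
  have hr' : (0 : ℝ) < r := by exact_mod_cast hr
  have hs' : (0 : ℝ) < s := by exact_mod_cast hs
  obtain ⟨b, hb'⟩ := T.exists_rightSingularBasis finrank_euclideanSpace_fin
  have hb : T.IsRightSingularBasis b := hb'
  set B : ℕ → EuclideanSpace ℝ (Fin n) →ₗ[ℝ] EuclideanSpace ℝ (Fin m) := fun i =>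
    T.singularPart b (r + s + i * s) (r + s + (i + 1) * s) with hB
  set H := T.singularPart b 0 (r + s) with hH
  -- Since `s ≥ 1`, `n` blocks exhaust all indices; the surplus ones are zero.
  have hdec : H + ∑ i ∈ Finset.range n, B i = T := by
    rw [hH, hB, T.singularPart_add_sum, T.singularPart_eq_self]
    exact (Nat.le_mul_of_pos_right n hs).trans (Nat.le_add_left _ _)
  have hH' : 𝒜 (Matrix.toEuclideanLin.symm H) =
      -∑ i ∈ Finset.range n, 𝒜 (Matrix.toEuclideanLin.symm (B i)) := by
    rw [← hdec, map_add, map_add, map_sum, map_sum] at hT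
    exact eq_neg_of_add_eq_zero_left hT
  set Q := (∑ j ∈ Finset.range r, T.singularValues j ^ 2) ^ (q / 2) with hQ
  -- RUB applies to all of `H`, of rank at most `r + s`; afterwards only the first `r` singular
  -- values are kept, to match the block estimate.
  have hhead : C₁ * Q ≤ lqNorm q (𝒜 (Matrix.toEuclideanLin.symm H)) ^ q / L := by
    refine le_trans ?_ (h.bounds hq0 H
      ((T.finrank_range_singularPart_le b _ _).trans (by omega))).1
    rw [hH, hb.sum_singularValues_singularPart_sq, ← Finset.range_eq_Ico]
    refine mul_le_mul_of_nonneg_left (Real.rpow_le_rpow (Finset.sum_nonneg fun _ _ => sq_nonneg _)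
      ?_ (half_pos hq0).le) hC₁.le
    exact Finset.sum_le_sum_of_subset_of_nonneg (Finset.range_mono (by omega))
      fun _ _ _ => sq_nonneg _
  have htail : ∀ i, lqNorm q (𝒜 (Matrix.toEuclideanLin.symm (B i))) ^ q / L ≤
      C₂ * (∑ j ∈ Finset.Ico (r + s + i * s) (r + s + (i + 1) * s),
        T.singularValues j ^ 2) ^ (q / 2) := fun i => by
    rw [← hb.sum_singularValues_singularPart_sq]
    refine (h.bounds hq0 (B i) ((T.finrank_range_singularPart_le b _ _).trans ?_)).2
    rw [add_mul, one_mul]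
    omega
  have hmain : C₁ * Q ≤ C₂ * ∑ i ∈ Finset.range n,
      (∑ j ∈ Finset.Ico (r + s + i * s) (r + s + (i + 1) * s),
        T.singularValues j ^ 2) ^ (q / 2) := by
    refine hhead.trans ?_
    rw [hH', lqNorm_neg, Finset.mul_sum]
    refine le_trans ?_ (Finset.sum_le_sum fun i _ => htail i)
    rw [← Finset.sum_div]
    exact div_le_div_of_nonneg_right (lqNorm_sum_rpow_le hq0 hq _ _) (Nat.cast_nonneg _)
  have hblocks := sum_blocks_le T.singularValues_nonneg T.singularValues_antitone hp (by linarith)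
    hpq hr hs hnull n
  rw [← hQ] at hblocks
  by_contra hT0
  have hτ0 : 0 < T.singularValues 0 := by
    rw [T.singularValues_pos_iff_ne_zero]
    intro h0
    refine hT0 (LinearMap.singularValues_eq_zero_iff T |>.1 (Finsupp.ext fun j => ?_))
    exact le_antisymm ((T.singularValues_antitone (Nat.zero_le j)).trans h0.le)
      (T.singularValues_nonneg j)
  have hQ0 : 0 < Q := by
    refine Real.rpow_pos_of_pos (lt_of_lt_of_le (pow_pos hτ0 2) ?_) _
    exact Finset.single_le_sum (f := fun j => T.singularValues j ^ 2) (fun _ _ => sq_nonneg _)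
      (Finset.mem_range.2 hr)
  -- Positivity is not assumed: it follows because `C₂` times a nonnegative sum is at least `C₁ * Q
  -- > 0`.
  have hC₂ : 0 < C₂ := by
    by_contra hneg
    have : C₂ * ∑ i ∈ Finset.range n,
        (∑ j ∈ Finset.Ico (r + s + i * s) (r + s + (i + 1) * s),
          T.singularValues j ^ 2) ^ (q / 2) ≤ 0 :=
      mul_nonpos_of_nonpos_of_nonneg (not_lt.1 hneg) (Finset.sum_nonneg fun i _ =>
        Real.rpow_nonneg (Finset.sum_nonneg fun _ _ => sq_nonneg _) _)
    have := mul_pos hC₁ hQ0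
    linarith
  have hk : (0 : ℝ) < (s : ℝ) / r := div_pos hs' hr'
  have h1 : C₁ * Q ≤ C₂ * ((s : ℝ) / r) ^ (q / 2 - q / p) * Q := by
    rw [mul_assoc]
    exact hmain.trans (mul_le_mul_of_nonneg_left hblocks hC₂.le)
  have h2 : C₁ ≤ C₂ * ((s : ℝ) / r) ^ (q / 2 - q / p) := le_of_mul_le_mul_right h1 hQ0
  rw [show q / 2 - q / p = -((1 / p - 1 / 2) * q) by ring, Real.rpow_neg hk.le,
    ← div_eq_mul_inv, le_div_iff₀ (Real.rpow_pos_of_pos hk _)] at h2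
  rw [div_lt_iff₀ hC₁] at hC
  linarith

end Matrices

/-! ### Uniqueness of the Schatten minimizer. -/

theorem mainTheorem1 {m n L : ℕ}
    (𝒜 : Matrix (Fin m) (Fin n) ℝ →ₗ[ℝ] (Fin L → ℝ))
    (r : ℕ) (hr : 0 < r)
    (k : ℝ) (hk : 1 < k) (s : ℕ) (hs : (s : ℝ) = k * (r : ℝ))
    (p q : ℝ) (hp : 0 < p) (hpq : p ≤ q) (hq : q ≤ 1)
    (C₁ C₂ : ℝ) (hC₁ : 0 < C₁)
    -- the order is `(k + 1) r = s + r`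
    (hRUB : LqRUB 𝒜 q (s + r) C₁ C₂)
    (hC : C₂ / C₁ < k ^ ((1 / p - 1 / 2) * q)) :
    ∀ X : Matrix (Fin m) (Fin n) ℝ, X.rank ≤ r →
      ∀ Xhat : Matrix (Fin m) (Fin n) ℝ,
        IsSchattenMinimizer 𝒜 (𝒜 X) {0} p Xhat ↔ Xhat = X := by
  intro X hX
  have hr' : (0 : ℝ) < r := by exact_mod_cast hr
  have hs0 : 0 < s := by
    have : (0 : ℝ) < s := by rw [hs]; exact mul_pos (by linarith) hr'
    exact_mod_cast this
  have hsk : k = (s : ℝ) / r := by rw [hs, mul_div_cancel_right₀ _ hr'.ne']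
  rw [hsk] at hC
  -- This serves both directions: a minimizer does no worse than `X`, and a competitor strictly
  -- better than `X` would have to equal `X`.
  have huniq : ∀ Y : Matrix (Fin m) (Fin n) ℝ, 𝒜 X - 𝒜 Y ∈ ({0} : Set (Fin L → ℝ)) →
      schattenNorm p Y ^ p ≤ schattenNorm p X ^ p → Y = X := by
    intro Y hY hYX
    rw [schattenNorm_rpow_eq hp, schattenNorm_rpow_eq hp, div_self hp.ne', Real.rpow_one,
      Real.rpow_one] at hYX
    have hnull := LinearMap.sum_Ico_singularValues_rpow_le hp (hpq.trans hq)
      (Matrix.toEuclideanLin X) (Matrix.toEuclideanLin Y) finrank_euclideanSpace_fin (r := r)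
      (by rwa [← rank_eq_finrank_range_toEuclideanLin]) hYX
    have h0 := hRUB.eq_zero_of_head_dominates hr hs0 hp hpq hq hC₁ hC _
      (by rw [← map_sub, LinearEquiv.symm_apply_apply, map_sub]; exact hY) hnull
    rw [← map_sub, LinearEquiv.map_eq_zero_iff, sub_eq_zero] at h0
    exact h0.symm
  intro Xhat
  constructor
  · rintro ⟨h1, h2⟩
    exact huniq Xhat h1 (h2 X (by simp))
  · rintro rfl
    refine ⟨by simp, fun Y hY => ?_⟩
    by_contra hlt
    exact hlt (le_of_eq (by rw [huniq Y hY (not_le.1 hlt).le]))
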